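/- **Setting.** Let $V$ be a finite set and let $P$ be the joint distribution of random variables $(X_v)_{v\in V}$ with values in standard Borel spaces. Write $A\perp B\mid S$ for conditional independence under $P$ of $(X_a)_{a\in A}$ and $(X_b)_{b\in B}$ given $(X_s)_{s\in S}$. Consider graphs on $V$ without loops or multiple edges, whose edges are directed ($a\to b$) or undirected ($a-b$). - $G$ is an *LWF chain graph* if it has no partially directed cycle, i.e. no cyclic sequence of at least three distinct vertices, each joined to the next by $-$ or $\to$, at least once by $\to$. - A *minimal complex* is an induced subgraph of the form $u\to w_1-\cdots-w_r\gets v$ with $r\ge 1$. - The *skeleton* is obtained by making all edges undirected. The *pattern* is obtained by removing the directions of all arrows that belong to no minimal complex. - For disjoint $A,B,S\subseteq V$, $S$ *c-separates* $A$ from $B$ in $G$ if $S$ separates $A$ from $B$ in the moral graph of the subgraph induced on the smallest set that contains $A\cup B\cup S$ and is closed under taking parents and neighbours. The moral graph joins two distinct vertices if they are adjacent or have children in the same connected component of the subgraph of undirected edges. - $P$ is *faithful* to $G$ if, for all disjoint $A,B,S$, $A\perp B\mid S$ holds exactly when $S$ c-separates $A$ from $B$ in $G$. **Algorithm (SPC4LWF,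 stable PC-like).** Start with the complete undirected graph $H$ on $V$. 1. *Skeleton recovery.* For $i=0,1,\dots,|V|-2$: store the current adjacency sets $a_H(x)$ of all vertices $x$. Then select, in some order, all ordered pairs $(u,v)$ with $u\in a_H(v)$ and $|a_H(u)\setminus\{v\}|\ge i$. For each of them, if there is $S\subseteq a_H(u)\setminus\{v\}$ with $|S|=i$ for which $u\perp v\mid S$ is reported, choose such an $S$, set $S_{uv}=S_{vu}=S$ and remove the edge $u-v$ from $H$. (A pair whose edge has already been removed at the same level may be treated again or passed over.) 2. *Complex recovery.* Let $H^*=H$. For all ordered pairs $(u,v)$ of distinct vertices that are not adjacent in $H$ and all $w$ such that $u-w$ is at that time an undirected edge of $H^*$, in some order: if $u\not\perp v\mid S_{uv}\cup\{w\}$ is reported, replace $u-w$ by $u\to w$ in $H^*$. 3. Output the pattern of $H^*$. **Theorem.** Let $P$ be faithful to an LWF chain graph $G$, and assume that the conditional-independence information is perfect: for all distinct $u,v\in V$ and all $S\subseteq V\setminus\{u,v\}$, the algorithm is told that $u\perp v\mid S$ exactly when this holds under $P$. Then, for all orders of selection and all choices of separating sets, the algorithm outputs the pattern of $G$. In particular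 the output has the same skeleton and the same minimal complexes as $G$. -/

import Mathlib

namespace LWF

/-! ## Graphs with directed and undirected edges -/

/-- A graph with directed and undirected edges and no loops or multiple edges. It is given by its set
of ordered pairs: `a → b` if `(a, b)` is in the set and `(b, a)` is not, and `a − b` if both are. -/
@[ext]
structure MixedGraph (V : Type*) where
  E : V → V → Prop
  irrefl : ∀ a, ¬ E a a

namespace MixedGraph

variable {V : Type*}

/-- The directed edge `a → b`. -/
def Arrow (G : MixedGraph V) (a b : V) : Prop := G.E a b ∧ ¬ G.E b a

/-- The undirected edge `a − b`. -/
def Line (G : MixedGraph V) (a b : V) : Prop := G.E a b ∧ G.E b a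

/-- The skeleton: all edges become undirected. -/
def skeleton (G : MixedGraph V) : SimpleGraph V where
  Adj a b := G.E a b ∨ G.E b a
  symm := ⟨fun _ _ h => h.symm⟩
  loopless := ⟨fun a h => h.elim (G.irrefl a) (G.irrefl a)⟩

/-- A chain graph: there is no partially directed cycle, i.e. no cyclic sequence of at least three
distinct vertices, each joined to the next by `−` or `→`, at least once by `→`.
(Addition in `Fin (n + 3)` is cyclic.) -/
def IsChainGraph (G : MixedGraph V) : Prop :=
  ∀ (n : ℕ) (v : Fin (n + 3) → V), Function.Injective v →
    (∀ i, G.Line (v i) (v (i + 1)) ∨ G.Arrow (v i) (v (i + 1))) →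
    ¬ ∃ j, G.Arrow (v j) (v (j + 1))

/-- `x 0 → x 1 − ⋯ − x (r + 1) ← x (r + 2)` is a minimal complex: the subgraph induced on the
distinct vertices `x i` has exactly these edges. -/
structure IsMinimalComplex (G : MixedGraph V) (r : ℕ) (x : Fin (r + 3) → V) : Prop where
  inj : Function.Injective x
  adj_iff : ∀ i j : Fin (r + 3), G.skeleton.Adj (x i) (x j) ↔ i.val + 1 = j.val ∨ j.val + 1 = i.val
  left : G.Arrow (x ⟨0, by omega⟩) (x ⟨1, by omega⟩)
  right : G.Arrow (x ⟨r + 2, by omega⟩) (x ⟨r + 1, by omega⟩)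
  middle : ∀ i j : Fin (r + 3), 0 < i.val → i.val + 1 = j.val → j.val < r + 2 → G.Line (x i) (x j)

/-- `a → b` is a complex arrow: one of the two arrows of a minimal complex. -/
def IsComplexArrow (G : MixedGraph V) (a b : V) : Prop :=
  ∃ (r : ℕ) (x : Fin (r + 3) → V), G.IsMinimalComplex r x ∧
    ((a = x ⟨0, by omega⟩ ∧ b = x ⟨1, by omega⟩) ∨
      (a = x ⟨r + 2, by omega⟩ ∧ b = x ⟨r + 1, by omega⟩))

/-- The pattern: the directions of all arrows that are not complex arrows are removed. -/
def pattern (G : MixedGraph V) : MixedGraph V where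
  E a b := G.E a b ∨ (G.Arrow b a ∧ ¬ G.IsComplexArrow b a)
  irrefl a h := h.elim (G.irrefl a) (fun h => G.irrefl a h.1.1)

/-- The subgraph induced on `A`; the vertices outside `A` are kept as isolated vertices. -/
def induce (G : MixedGraph V) (A : Set V) : MixedGraph V where
  E a b := a ∈ A ∧ b ∈ A ∧ G.E a b
  irrefl a h := G.irrefl a h.2.2

/-- The boundary of a vertex: its parents and neighbours. -/
def bd (G : MixedGraph V) (a : V) : Set V := {b | G.Arrow b a ∨ G.Line b a}

/-- `A` is ancestral if it contains the boundary of each of its elements. -/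
def IsAncestral (G : MixedGraph V) (A : Set V) : Prop := ∀ a ∈ A, G.bd a ⊆ A

/-- The smallest ancestral set containing `A`. -/
def An (G : MixedGraph V) (A : Set V) : Set V := ⋂₀ {B | A ⊆ B ∧ G.IsAncestral B}

/-- `a` and `b` are in the same chain component: they are joined by a chain of undirected edges. -/
def SameComponent (G : MixedGraph V) (a b : V) : Prop := Relation.ReflTransGen G.Line a b

/-- The moral graph. -/
def moral (G : MixedGraph V) : SimpleGraph V where
  Adj a b := a ≠ b ∧ (G.Arrow a b ∨ G.Line a b ∨ G.Arrow b a ∨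
    ∃ c d, G.SameComponent c d ∧ G.Arrow a c ∧ G.Arrow b d)
  symm := ⟨by
    rintro a b ⟨hne, h⟩
    refine ⟨hne.symm, ?_⟩
    rcases h with h | h | h | ⟨c, d, hcd, hac, hbd⟩
    · exact Or.inr (Or.inr (Or.inl h))
    · exact Or.inr (Or.inl ⟨h.2, h.1⟩)
    · exact Or.inl h
    · refine Or.inr (Or.inr (Or.inr ⟨d, c, ?_, hbd, hac⟩))
      have hs : Std.Symm G.Line := ⟨fun _ _ h => ⟨h.2, h.1⟩⟩
      exact Relation.ReflTransGen.stdSymm.symm _ _ hcd⟩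
  loopless := ⟨fun _ h => h.1 rfl⟩

/-- `S` c-separates `A` from `B`: every walk from `A` to `B` in the moral graph of the subgraph
induced on the smallest ancestral set containing `A ∪ B ∪ S` meets `S`. -/
def CSep (G : MixedGraph V) (A B S : Set V) : Prop :=
  ∀ᵉ (a ∈ A) (b ∈ B), ∀ p : (G.induce (G.An (A ∪ B ∪ S))).moral.Walk a b, ∃ s ∈ S, s ∈ p.support

/-- The graph with the edges of `H`, all of them undirected. -/
def ofSimpleGraph (H : SimpleGraph V) : MixedGraph V where
  E a b := H.Adj a b
  irrefl a h := H.ne_of_adj h rfl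

/-- Replace the edge `u − w` by `u → w`. -/
def orient (G : MixedGraph V) (u w : V) : MixedGraph V where
  E a b := G.E a b ∧ ¬ (a = w ∧ b = u)
  irrefl a h := G.irrefl a h.1

end MixedGraph

/-! ## Distributions -/

section Distributions

variable {V : Type*} {X : V → Type*} [m : ∀ v, MeasurableSpace (X v)]

/-- The σ-algebra generated by the coordinates in `A`. -/
@[reducible]
def coordAlg (X : V → Type*) [m : ∀ v, MeasurableSpace (X v)] (A : Set V) :
    MeasurableSpace (∀ v, X v) :=
  ⨆ a ∈ A, (m a).comap (fun x : ∀ v, X v => x a)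

theorem coordAlg_le (A : Set V) : coordAlg X A ≤ MeasurableSpace.pi :=
  iSup₂_le fun a _ => (measurable_pi_apply a).comap_le

/-- The coordinates in `A` are independent of those in `B` given those in `S`, under `P`. -/
def CondInd [Countable V] [∀ v, StandardBorelSpace (X v)]
    (P : MeasureTheory.Measure (∀ v, X v)) [MeasureTheory.IsFiniteMeasure P]
    (A B S : Set V) : Prop :=
  ProbabilityTheory.CondIndep (coordAlg X S) (coordAlg X A) (coordAlg X B) (coordAlg_le S) P

/-- `P` is faithful to `G`: for disjoint `A`, `B`, `S`, the conditional independence of `A` and `B`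
given `S` holds under `P` exactly if `S` c-separates `A` from `B` in `G`. -/
def Faithful [Countable V] [∀ v, StandardBorelSpace (X v)]
    (P : MeasureTheory.Measure (∀ v, X v)) [MeasureTheory.IsFiniteMeasure P]
    (G : MixedGraph V) : Prop :=
  ∀ A B S : Set V, Disjoint A B → Disjoint A S → Disjoint B S →
    (CondInd P A B S ↔ G.CSep A B S)

end Distributions

/-! ## The stable PC-like algorithm

It has access to the distribution only through the answers `ci u v S` to the questions whether the
variables `u` and `v` are conditionally independent given `S`. Choices that the algorithm leaves
open (the order in which pairs are selected, the choice among several separating sets) are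
nondeterministic, so every ordering of the variables is covered. -/

namespace SPC

variable {V : Type*}

/-- The data of the skeleton recovery: the current undirected graph and the recorded separating
sets (`none` if none has been recorded). -/
structure State (V : Type*) where
  H : SimpleGraph V
  sep : V → V → Option (Finset V)

/-- The complete graph, with no separating set recorded. -/
def State.init (V : Type*) : State V where
  H := ⊤
  sep _ _ := none

open Classical in
/-- Set `S_uv = S_vu = S` and remove the edge `u − v`. -/
noncomputable def State.remove (st : State V) (u v : V) (S : Finset V) : State V where
  H := st.H.deleteEdges {s(u, v)}
  sep a b := if (a = u ∧ b = v) ∨ (a = v ∧ b = u) then some S else st.sep a b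

/-- `S ⊆ a_H(u) \ v` has size `i` and is reported to separate `u` and `v`. Here and below `H₀` is the
graph at the beginning of level `i`, so that `H₀.neighborSet` is the stored family of adjacency
sets `a_H`. -/
def IsSeparator (ci : V → V → Finset V → Prop) (H₀ : SimpleGraph V) (i : ℕ) (u v : V)
    (S : Finset V) : Prop :=
  (S : Set V) ⊆ H₀.neighborSet u \ {v} ∧ S.card = i ∧ ci u v S

/-- Treatment of a selected ordered pair `(u, v)` at level `i`. (A pair whose edge has been removed
earlier at this level may be treated again or be passed over.) -/
inductive Visit (ci : V → V → Finset V → Prop) (H₀ : SimpleGraph V) (i : ℕ) (u v : V) :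
    State V → State V → Prop
  | remove (st : State V) (S : Finset V) (hS : IsSeparator ci H₀ i u v S) :
      Visit ci H₀ i u v st (st.remove u v S)
  | keep (st : State V) (hS : ¬ ∃ S, IsSeparator ci H₀ i u v S) : Visit ci H₀ i u v st st
  | skip (st : State V) (h : ¬ st.H.Adj u v) : Visit ci H₀ i u v st st

/-- Treatment of a list of ordered pairs, one after the other. -/
inductive VisitAll (ci : V → V → Finset V → Prop) (H₀ : SimpleGraph V) (i : ℕ) :
    List (V × V) → State V → State V → Prop
  | nil (st : State V) : VisitAll ci H₀ i [] st st
  | cons (u v : V) (ps : List (V × V)) (st₁ st₂ st₃ : State V)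
      (h : Visit ci H₀ i u v st₁ st₂) (hs : VisitAll ci H₀ i ps st₂ st₃) :
      VisitAll ci H₀ i ((u, v) :: ps) st₁ st₃

/-- Level `i`: the adjacency sets are stored, and all ordered pairs `(u, v)` with `u ∈ a_H(v)` and
`|a_H(u) \ v| ≥ i` are selected, in some order. -/
def Level (ci : V → V → Finset V → Prop) (i : ℕ) (st st' : State V) : Prop :=
  ∃ ps : List (V × V), ps.Nodup ∧
    (∀ u v, (u, v) ∈ ps ↔ u ∈ st.H.neighborSet v ∧ i ≤ (st.H.neighborSet u \ {v}).ncard) ∧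
    VisitAll ci st.H i ps st st'

/-- The levels `0, …, k - 1`, one after the other. -/
inductive Levels (ci : V → V → Finset V → Prop) : ℕ → State V → State V → Prop
  | zero (st : State V) : Levels ci 0 st st
  | succ (k : ℕ) (st₁ st₂ st₃ : State V) (hs : Levels ci k st₁ st₂) (h : Level ci k st₂ st₃) :
      Levels ci (k + 1) st₁ st₃

/-- `st` is a result of the skeleton recovery: the levels are `0, …, |V| - 2`. -/
def SkeletonRecovery [Fintype V] (ci : V → V → Finset V → Prop) (st : State V) : Prop :=
  Levels ci (Fintype.card V - 1) (State.init V) st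

open Classical in
/-- One step of the complex recovery: `u − w` is oriented as `u → w` if it is (still) an undirected
edge of `K` and `u`, `v` are reported to be dependent given `S_uv ∪ {w}`. -/
noncomputable def orientStep (ci : V → V → Finset V → Prop) (sep : V → V → Option (Finset V))
    (K : MixedGraph V) (t : V × V × V) : MixedGraph V :=
  if K.Line t.1 t.2.2 ∧ ∃ S, sep t.1 t.2.1 = some S ∧ ¬ ci t.1 t.2.1 (insert t.2.2 S) then
    K.orient t.1 t.2.2
  else K

/-- `K` is a result of the complex recovery, before the pattern is taken: starting from `H`, all
`(u, v, w)` with `u`, `v` distinct and non-adjacent and `u`, `w` adjacent are treated in some order. -/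
def ComplexRecovery (ci : V → V → Finset V → Prop) (st : State V) (K : MixedGraph V) : Prop :=
  ∃ ts : List (V × V × V), ts.Nodup ∧
    (∀ u v w, (u, v, w) ∈ ts ↔ u ≠ v ∧ ¬ st.H.Adj u v ∧ st.H.Adj u w) ∧
    K = ts.foldl (orientStep ci st.sep) (MixedGraph.ofSimpleGraph st.H)

/-- `K` is a possible output of the stable PC-like algorithm. -/
def IsOutput [Fintype V] (ci : V → V → Finset V → Prop) (K : MixedGraph V) : Prop :=
  ∃ (st : State V) (K₀ : MixedGraph V),
    SkeletonRecovery ci st ∧ ComplexRecovery ci st K₀ ∧ K = K₀.pattern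

end SPC

end LWF

/-! By faithfulness the answers `ci` are exactly c-separation in `G`, so the proof is purely
graphical.

Skeleton. Adjacent vertices stay adjacent in every moral graph, so no edge of `G` is ever deleted.
Of two non-adjacent vertices, at least one, say `u`, has no directed edge that starts a descending
path to the other, `v`; then the boundary of `u` separates them (`cSep_bd`). As the current graph
contains the skeleton, that boundary is among the candidate sets when the level reaches its size, so
the edge `u − v` goes.

Complexes. Let `S` separate `u` from `v`. Adding an element of the ancestral set of `{u, v} ∪ S`
leaves the moral graph unchanged and keeps the separation. A dependence given `S ∪ {w}` therefore
excludes `w → u` and `w − u`, and every orientation made is correct (`arrow_of_not_cSep_insert`).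
Conversely, conditioning on the child `w` of an end point of a minimal complex marries its two end
points, so every complex arrow is found (`IsMinimalComplex.not_cSep`).

The resulting graph thus has the skeleton of `G`, only arrows of `G`, and all its complex arrows.
Such a graph has the same minimal complexes as `G` (`IsRelaxation.isMinimalComplex_iff`), hence the
same pattern. -/

namespace LWF

namespace MixedGraph

variable {V : Type*} {G K : MixedGraph V}

/-! ### Boundaries, ancestral sets and partially directed cycles -/

theorem ne_of_E {a b : V} (h : G.E a b) : a ≠ b := by
  rintro rfl
  exact G.irrefl a h

theorem mem_bd {a b : V} : b ∈ G.bd a ↔ G.E b a := by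
  simp only [bd, Arrow, Line, Set.mem_ofPred_eq]
  tauto

theorem mem_An {A : Set V} {x : V} : x ∈ G.An A ↔ ∃ a ∈ A, Relation.ReflTransGen G.E x a := by
  constructor
  · intro h
    refine h {x | ∃ a ∈ A, Relation.ReflTransGen G.E x a} ⟨fun a ha => ⟨a, ha, .refl⟩, ?_⟩
    rintro y ⟨a, ha, hya⟩ z hz
    exact ⟨a, ha, .head (mem_bd.1 hz) hya⟩
  · rintro ⟨a, ha, h⟩ B ⟨hAB, hB⟩
    induction h using Relation.ReflTransGen.head_induction_on with
    | refl => exact hAB ha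
    | head hab _ ih => exact hB _ ih (mem_bd.2 hab)

theorem subset_An {A : Set V} : A ⊆ G.An A := fun a ha => mem_An.2 ⟨a, ha, .refl⟩

theorem An_insert_of_mem {A : Set V} {w : V} (hw : w ∈ G.An A) : G.An (insert w A) = G.An A := by
  ext x
  simp only [mem_An] at hw ⊢
  constructor
  · rintro ⟨a, rfl | ha, hxa⟩
    · obtain ⟨b, hb, hab⟩ := hw
      exact ⟨b, hb, hxa.trans hab⟩
    · exact ⟨a, ha, hxa⟩
  · rintro ⟨a, ha, hxa⟩
    exact ⟨a, Or.inr ha, hxa⟩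

theorem induce_arrow {A : Set V} {a b : V} :
    (G.induce A).Arrow a b ↔ a ∈ A ∧ b ∈ A ∧ G.Arrow a b := by
  simp only [Arrow, induce]
  tauto

theorem induce_line {A : Set V} {a b : V} :
    (G.induce A).Line a b ↔ a ∈ A ∧ b ∈ A ∧ G.Line a b := by
  simp only [Line, induce]
  tauto

/-- Two related points are joined by a chain without repetitions. -/
theorem exists_nodup_chain {r : V → V → Prop} {a b : V} (h : Relation.ReflTransGen r a b) :
    ∃ l : List V, (a :: l).Nodup ∧ (a :: l).IsChain r ∧
      (a :: l).getLast (List.cons_ne_nil _ _) = b := by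
  induction h using Relation.ReflTransGen.head_induction_on with
  | refl => exact ⟨[], by simp⟩
  | @head a c hac _ ih =>
    obtain ⟨l, hnd, hch, hlast⟩ := ih
    by_cases ha : a ∈ c :: l
    · obtain ⟨s, t, hst⟩ := List.append_of_mem ha
      refine ⟨t, ?_, ?_, ?_⟩
      · rw [hst] at hnd
        exact (List.nodup_append.1 hnd).2.1
      · rw [hst] at hch
        exact (List.isChain_append.1 hch).2.1
      · rw [← hlast]
        simp only [hst]
        rw [List.getLast_append_of_ne_nil _ (List.cons_ne_nil _ _)]
    · exact ⟨c :: l, List.nodup_cons.2 ⟨ha, hnd⟩, List.isChain_cons_cons.2 ⟨hac, hch⟩, by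
        simpa using hlast⟩

/-- A return path can be made free of repetitions, and `a → b` closes it to a partially directed
cycle. -/
theorem IsChainGraph.not_reflTransGen (hG : G.IsChainGraph) {a b : V} (hab : G.Arrow a b) :
    ¬ Relation.ReflTransGen G.E b a := by
  intro h
  obtain ⟨l, hnd, hch, hlast⟩ := exists_nodup_chain h
  -- Paths with one or two vertices give no cycle of length three; they would be a loop or an edge
  -- `b → a` or `b − a`.
  match l, hnd, hch, hlast with
  | [], _, _, hlast => exact ne_of_E hab.1 (by simpa using hlast.symm)
  | [c], _, hch, hlast =>
    obtain rfl : c = a := by simpa using hlast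
    exact hab.2 (by simpa using hch)
  | c :: d :: l, hnd, hch, hlast =>
    set L := b :: c :: d :: l with hL
    have hlen : L.length = l.length + 3 := by simp [hL]
    let v : Fin (l.length + 3) → V := fun i => L[i.val]'(by omega)
    have hwrap : v (Fin.last (l.length + 2)) = a := by
      rw [← hlast, List.getLast_eq_getElem]
      simp only [v, Fin.val_last]
      rfl
    have hzero : v (Fin.last (l.length + 2) + 1) = b := by
      simp [v, Fin.last_add_one, hL]
    refine hG l.length v (fun i j hij => Fin.ext ((hnd.getElem_inj_iff).1 hij)) (fun i => ?_)
      ⟨Fin.last _, by rwa [hwrap, hzero]⟩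
    rcases eq_or_ne i (Fin.last (l.length + 2)) with rfl | hi
    · right
      rwa [hwrap, hzero]
    · have hi' : (i + 1).val = i.val + 1 :=
        Fin.val_add_one_of_lt (lt_of_le_of_ne (Fin.le_last i) hi)
      have hE : G.E (v i) (v (i + 1)) := by
        simp only [v, hi']
        exact List.isChain_iff_getElem.1 hch i.val (by have := (i + 1).isLt; omega)
      by_cases hE' : G.E (v (i + 1)) (v i)
      · exact Or.inl ⟨hE, hE'⟩
      · exact Or.inr ⟨hE, hE'⟩

/-! ### Separation of two vertices -/

theorem CSep.symm {A B S : Set V} (h : G.CSep A B S) : G.CSep B A S := by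
  intro b hb a ha
  rw [Set.union_comm B A]
  intro p
  obtain ⟨s, hs, hp⟩ := h a ha b hb p.reverse
  exact ⟨s, hs, by simpa using hp⟩

theorem not_cSep_of_adj {u v : V} {S : Set V} (hu : u ∉ S) (hv : v ∉ S)
    (h : (G.induce (G.An ({u} ∪ {v} ∪ S))).moral.Adj u v) : ¬ G.CSep {u} {v} S := by
  intro hsep
  obtain ⟨s, hs, hp⟩ := hsep u rfl v rfl h.toWalk
  simp only [SimpleGraph.Adj.toWalk, SimpleGraph.Walk.support_cons, SimpleGraph.Walk.support_nil,
    List.mem_cons, List.not_mem_nil, or_false] at hp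
  rcases hp with rfl | rfl
  exacts [hu hs, hv hs]

theorem not_cSep_of_skeleton_adj {u v : V} {S : Set V} (hu : u ∉ S) (hv : v ∉ S)
    (h : G.skeleton.Adj u v) : ¬ G.CSep {u} {v} S := by
  refine not_cSep_of_adj hu hv ⟨h.ne, ?_⟩
  have hu' : u ∈ G.An ({u} ∪ {v} ∪ S) := subset_An (by simp)
  have hv' : v ∈ G.An ({u} ∪ {v} ∪ S) := subset_An (by simp)
  simp only [induce_arrow, induce_line, hu', hv', true_and]
  simp only [skeleton] at h
  simp only [Arrow, Line]
  tauto

/-- The local Markov property: a vertex is separated by its boundary from each non-adjacent vertex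
that is not a proper descendant. -/
theorem cSep_bd (hG : G.IsChainGraph) {u v : V} (huv : u ≠ v)
    (hd : ∀ c, G.Arrow u c → ¬ Relation.ReflTransGen G.E c v) : G.CSep {u} {v} (G.bd u) := by
  -- With no child of `u` in the ancestral set, a moral edge at `u` is neither an arrow out of `u`
  -- nor a marriage, so the first step of a walk enters the boundary.
  have hno : ∀ c, G.Arrow u c → c ∉ G.An ({u} ∪ {v} ∪ G.bd u) := by
    intro c huc hc
    obtain ⟨a, (rfl | rfl) | ha, hca⟩ := mem_An.1 hc
    · exact hG.not_reflTransGen huc hca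
    · exact hd c huc hca
    · exact hG.not_reflTransGen huc (hca.tail (mem_bd.1 ha))
  rintro _ rfl _ rfl p
  cases p with
  | nil => exact absurd rfl huv
  | @cons _ c _ h p =>
    refine ⟨c, ?_, List.mem_cons_of_mem _ p.start_mem_support⟩
    obtain ⟨_, h | h | h | ⟨c', _, _, h, _⟩⟩ := h
    · exact absurd (induce_arrow.1 h).2.1 (hno c (induce_arrow.1 h).2.2)
    · exact mem_bd.2 (induce_line.1 h).2.2.2
    · exact mem_bd.2 (induce_arrow.1 h).2.2.1
    · exact absurd (induce_arrow.1 h).2.1 (hno c' (induce_arrow.1 h).2.2)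

/-- If both local separations failed, `u → c ⇝ v → d ⇝ u` would contradict the chain graph property.
-/
theorem cSep_bd_or (hG : G.IsChainGraph) {u v : V} (huv : u ≠ v) :
    G.CSep {u} {v} (G.bd u) ∨ G.CSep {v} {u} (G.bd v) := by
  by_cases hd : ∀ c, G.Arrow u c → ¬ Relation.ReflTransGen G.E c v
  · exact Or.inl (cSep_bd hG huv hd)
  · push Not at hd
    obtain ⟨c, huc, hcv⟩ := hd
    exact Or.inr (cSep_bd hG huv.symm fun d hvd hdu =>
      hG.not_reflTransGen huc ((hcv.tail hvd.1).trans hdu))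

/-- Separation is not monotone in `S` in general, since a larger `S` may enlarge the moral graph;
here the ancestral set does not grow. -/
theorem CSep.insert_of_mem_An {u v w : V} {S : Set V} (h : G.CSep {u} {v} S)
    (hw : w ∈ G.An ({u} ∪ {v} ∪ S)) : G.CSep {u} {v} (insert w S) := by
  intro a ha b hb
  rw [Set.union_insert, An_insert_of_mem hw]
  intro p
  obtain ⟨s, hs, hp⟩ := h a ha b hb p
  exact ⟨s, Or.inr hs, hp⟩

theorem arrow_of_not_cSep_insert {u v w : V} {S : Set V} (h : G.CSep {u} {v} S)
    (hw : ¬ G.CSep {u} {v} (insert w S)) (hadj : G.skeleton.Adj u w) : G.Arrow u w := by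
  have hwu : ¬ G.E w u := fun hwu => hw (h.insert_of_mem_An
    (mem_An.2 ⟨u, by simp, .single hwu⟩))
  exact ⟨hadj.resolve_right hwu, hwu⟩

/-! ### Complexes -/

theorem IsMinimalComplex.not_adj {r : ℕ} {x : Fin (r + 3) → V} (h : G.IsMinimalComplex r x) :
    ¬ G.skeleton.Adj (x ⟨0, by omega⟩) (x ⟨r + 2, by omega⟩) := by
  rw [h.adj_iff]
  simp

theorem IsMinimalComplex.reverse {r : ℕ} {x : Fin (r + 3) → V} (h : G.IsMinimalComplex r x) :
    G.IsMinimalComplex r (x ∘ Fin.rev) where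
  inj := h.inj.comp Fin.rev_injective
  adj_iff i j := by
    simp only [Function.comp_apply, h.adj_iff, Fin.val_rev]
    omega
  left := by
    convert h.right using 2
    all_goals exact congrArg x (Fin.ext (by simp only [Fin.val_rev]; omega))
  right := by
    convert h.left using 2
    all_goals exact congrArg x (Fin.ext (by simp only [Fin.val_rev]; omega))
  middle i j hi hij hj := by
    have := h.middle j.rev i.rev (by simp only [Fin.val_rev]; omega)
      (by simp only [Fin.val_rev]; omega) (by simp only [Fin.val_rev]; omega)
    exact ⟨this.2, this.1⟩

/-- Each complex arrow is the first arrow of a minimal complex. -/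
theorem isComplexArrow_iff {a b : V} : G.IsComplexArrow a b ↔
    ∃ (r : ℕ) (x : Fin (r + 3) → V), G.IsMinimalComplex r x ∧
      a = x ⟨0, by omega⟩ ∧ b = x ⟨1, by omega⟩ := by
  constructor
  · rintro ⟨r, x, h, ⟨ha, hb⟩ | ⟨ha, hb⟩⟩
    · exact ⟨r, x, h, ha, hb⟩
    · refine ⟨r, _, h.reverse, ha.trans ?_, hb.trans ?_⟩ <;>
        simp [Fin.rev]
  · rintro ⟨r, x, h, hab⟩
    exact ⟨r, x, h, Or.inl hab⟩

theorem IsComplexArrow.arrow {a b : V} (h : G.IsComplexArrow a b) : G.Arrow a b := by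
  obtain ⟨r, x, hx, rfl, rfl⟩ := isComplexArrow_iff.1 h
  exact hx.left

/-- Ancestral sets are closed under neighbours, so one middle vertex brings in the whole undirected
path. -/
theorem IsMinimalComplex.sameComponent_induce {r : ℕ} {x : Fin (r + 3) → V}
    (h : G.IsMinimalComplex r x) {A : Set V} (hA : x ⟨1, by omega⟩ ∈ G.An A) :
    ∀ (k : ℕ) (hk : k ≤ r), x ⟨k + 1, by omega⟩ ∈ G.An A ∧
      (G.induce (G.An A)).SameComponent (x ⟨1, by omega⟩) (x ⟨k + 1, by omega⟩) := by
  intro k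
  induction k with
  | zero => exact fun _ => ⟨hA, .refl⟩
  | succ k ih =>
    intro hk
    obtain ⟨hmem, hcomp⟩ := ih (by omega)
    have hline : G.Line (x ⟨k + 1, by omega⟩) (x ⟨k + 1 + 1, by omega⟩) :=
      h.middle _ _ (by simp) rfl (by simp only; omega)
    have hmem' : x ⟨k + 1 + 1, by omega⟩ ∈ G.An A := by
      obtain ⟨a, ha, hxa⟩ := mem_An.1 hmem
      exact mem_An.2 ⟨a, ha, .head hline.2 hxa⟩
    exact ⟨hmem', hcomp.tail (induce_line.2 ⟨hmem, hmem', hline⟩)⟩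

/-- The end points of a minimal complex are not separated given a set that contains the child of
one of them. -/
theorem IsMinimalComplex.not_cSep {r : ℕ} {x : Fin (r + 3) → V} (h : G.IsMinimalComplex r x)
    {S : Set V} (hu : x ⟨0, by omega⟩ ∉ S) (hv : x ⟨r + 2, by omega⟩ ∉ S)
    (hw : x ⟨1, by omega⟩ ∈ S) :
    ¬ G.CSep {x ⟨0, by omega⟩} {x ⟨r + 2, by omega⟩} S := by
  refine not_cSep_of_adj hu hv ⟨fun he => ?_, Or.inr (Or.inr (Or.inr ?_))⟩
  · simpa using h.inj he
  · obtain ⟨hmem, hcomp⟩ := h.sameComponent_induce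
      (A := {x ⟨0, by omega⟩} ∪ {x ⟨r + 2, by omega⟩} ∪ S) (subset_An (Or.inr hw)) r le_rfl
    exact ⟨_, _, hcomp, induce_arrow.2 ⟨subset_An (by simp), subset_An (Or.inr hw), h.left⟩,
      induce_arrow.2 ⟨subset_An (by simp), hmem, h.right⟩⟩

/-! ### Relaxations and patterns -/

/-- `K` arises from `G` by removing directions of arrows that are not complex arrows. -/
structure IsRelaxation (K G : MixedGraph V) : Prop where
  skeleton_eq : K.skeleton = G.skeleton
  arrow_of_arrow : ∀ {a b}, K.Arrow a b → G.Arrow a b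
  arrow_of_isComplexArrow : ∀ {a b}, G.IsComplexArrow a b → K.Arrow a b

theorem line_iff {a b : V} :
    G.Line a b ↔ G.skeleton.Adj a b ∧ ¬ G.Arrow a b ∧ ¬ G.Arrow b a := by
  simp only [Line, skeleton, Arrow]
  tauto

theorem IsRelaxation.line (h : K.IsRelaxation G) {a b : V} (hab : G.Line a b) : K.Line a b := by
  rw [line_iff] at hab ⊢
  rw [h.skeleton_eq]
  exact ⟨hab.1, fun hK => hab.2.1 (h.arrow_of_arrow hK), fun hK => hab.2.2 (h.arrow_of_arrow hK)⟩

/-- In a sequence that begins with a `P` and ends with a `Q` there is a `P` that is followed by a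
`Q` with neither in between. -/
theorem exists_consecutive {P Q : ℕ → Prop} {n : ℕ} (h0 : P 0) (hn : Q n)
    (hPQ : ∀ k ≤ n, P k → ¬ Q k) :
    ∃ i j, i < j ∧ j ≤ n ∧ P i ∧ Q j ∧ ∀ k, i < k → k < j → ¬ P k ∧ ¬ Q k := by
  classical
  -- `j` is the first `Q` and `i` the last `P` up to `j`.
  have hex : ∃ j, Q j := ⟨n, hn⟩
  have hjn : Nat.find hex ≤ n := Nat.find_min' hex hn
  have hPi := Nat.findGreatest_spec (P := P) (Nat.zero_le (Nat.find hex)) h0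
  refine ⟨Nat.findGreatest P (Nat.find hex), Nat.find hex, ?_, hjn, hPi, Nat.find_spec hex,
    fun k hik hkj => ⟨Nat.findGreatest_is_greatest hik hkj.le, Nat.find_min hex hkj⟩⟩
  refine lt_of_le_of_ne (Nat.findGreatest_le _) fun he => ?_
  rw [he] at hPi
  exact hPQ _ hjn hPi (Nat.find_spec hex)

/-- The danger is a complex of `K` whose middle contains arrows of `G`. Two consecutive arrows
pointing towards each other bound a minimal complex of `G`; its arrows survive in `K`, so they
cannot lie in the undirected middle and must be the two end arrows. -/
theorem IsRelaxation.isMinimalComplex_iff (h : K.IsRelaxation G) {r : ℕ} {x : Fin (r + 3) → V} :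
    K.IsMinimalComplex r x ↔ G.IsMinimalComplex r x := by
  constructor
  · intro hx
    have hadj : ∀ i j : Fin (r + 3),
        G.skeleton.Adj (x i) (x j) ↔ i.val + 1 = j.val ∨ j.val + 1 = i.val := by
      rw [← h.skeleton_eq]
      exact hx.adj_iff
    -- `P k` and `Q k`: the edge between `x k` and `x (k + 1)` points forwards or backwards in `G`.
    obtain ⟨i, j, hij, hj, ⟨hi', hPi⟩, ⟨hj', hQj⟩, hbetween⟩ :=
      exists_consecutive (n := r + 1)
        (P := fun k => ∃ hk : k + 1 < r + 3, G.Arrow (x ⟨k, by omega⟩) (x ⟨k + 1, hk⟩))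
        (Q := fun k => ∃ hk : k + 1 < r + 3, G.Arrow (x ⟨k + 1, hk⟩) (x ⟨k, by omega⟩))
        ⟨by omega, h.arrow_of_arrow hx.left⟩ ⟨by omega, h.arrow_of_arrow hx.right⟩
        (fun k _ hP hQ => hP.2.2 hQ.2.1)
    have hlines : ∀ (k : ℕ) (hk : k + 1 < r + 3), i < k → k < j →
        G.Line (x ⟨k, by omega⟩) (x ⟨k + 1, hk⟩) := fun k hk hik hkj =>
      line_iff.2 ⟨(hadj _ _).2 (Or.inl rfl), fun hP => (hbetween k hik hkj).1 ⟨hk, hP⟩,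
        fun hQ => (hbetween k hik hkj).2 ⟨hk, hQ⟩⟩
    -- The vertices `x i, …, x (j + 1)` number `j - i + 2 = (j - i - 1) + 3`.
    have hsub : G.IsMinimalComplex (j - i - 1) fun k => x ⟨i + k.val, by omega⟩ := by
      refine ⟨fun k l hkl => ?_, fun k l => ?_, hPi, ?_, fun k l hk hkl hl => ?_⟩
      · have := hx.inj hkl
        simp only [Fin.mk.injEq] at this
        exact Fin.ext (by omega)
      · rw [hadj]
        simp only
        omega
      · convert hQj using 3 <;> (simp only; omega)
      · have := hlines (i + k.val) (by omega) (by omega) (by omega)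
        convert this using 3
        omega
    have hKi : K.Arrow (x ⟨i, by omega⟩) (x ⟨i + 1, hi'⟩) :=
      h.arrow_of_isComplexArrow ⟨_, _, hsub, Or.inl ⟨rfl, rfl⟩⟩
    have hKj : K.Arrow (x ⟨j + 1, hj'⟩) (x ⟨j, by omega⟩) := by
      refine h.arrow_of_isComplexArrow ⟨_, _, hsub, Or.inr ⟨?_, ?_⟩⟩
      · congr 2; simp only; omega
      · congr 2; simp only; omega
    have hi0 : i = 0 := by
      by_contra hi0
      exact hKi.2 (hx.middle ⟨i, by omega⟩ ⟨i + 1, hi'⟩ (by simp only; omega) rfl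
        (by simp only; omega)).2
    have hjr : j = r + 1 := by
      by_contra hjr
      exact hKj.2 (hx.middle ⟨j, by omega⟩ ⟨j + 1, hj'⟩ (by simp only; omega) rfl
        (by simp only; omega)).1
    refine ⟨hx.inj, hadj, h.arrow_of_arrow hx.left, h.arrow_of_arrow hx.right,
      fun k l hk hkl hl => ?_⟩
    have := hlines k.val (by omega) (by omega) (by omega)
    convert this using 2
    exact Fin.ext hkl.symm
  · intro hx
    exact ⟨hx.inj, by rw [h.skeleton_eq]; exact hx.adj_iff,
      h.arrow_of_isComplexArrow ⟨r, x, hx, Or.inl ⟨rfl, rfl⟩⟩,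
      h.arrow_of_isComplexArrow ⟨r, x, hx, Or.inr ⟨rfl, rfl⟩⟩,
      fun i j hi hij hj => h.line (hx.middle i j hi hij hj)⟩

theorem pattern_E {a b : V} :
    G.pattern.E a b ↔ G.skeleton.Adj a b ∧ ¬ G.IsComplexArrow b a := by
  have := @IsComplexArrow.arrow V G b a
  simp only [pattern, skeleton, Arrow] at this ⊢
  tauto

theorem IsRelaxation.pattern_eq (h : K.IsRelaxation G) : K.pattern = G.pattern := by
  ext a b
  simp only [pattern_E, h.skeleton_eq, IsComplexArrow, h.isMinimalComplex_iff]

/-- Used to transfer skeleton and minimal complexes from `G` to the output. -/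
theorem isRelaxation_pattern : G.pattern.IsRelaxation G where
  skeleton_eq := by
    ext a b
    simp only [pattern, skeleton, Arrow]
    tauto
  arrow_of_arrow {a b} h := by
    simp only [pattern, Arrow] at h ⊢
    tauto
  arrow_of_isComplexArrow {a b} h := by
    have hab := h.arrow
    have hba : ¬ G.IsComplexArrow b a := fun hba => hab.2 hba.arrow.1
    simp only [Arrow, pattern_E] at hab ⊢
    exact ⟨⟨Or.inl hab.1, hba⟩, fun h' => h'.2 h⟩

end MixedGraph

namespace SPC

variable {V : Type*} {G : MixedGraph V} {ci : V → V → Finset V → Prop}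

/-- The answers `ci` agree with separation in `G`. -/
def IsPerfect (ci : V → V → Finset V → Prop) (G : MixedGraph V) : Prop :=
  ∀ (u v : V) (S : Finset V), u ≠ v → u ∉ S → v ∉ S → (ci u v S ↔ G.CSep {u} {v} S)

/-! ### Skeleton recovery -/

/-- The current graph contains the skeleton of `G`, and a separating set is recorded for each pair
of non-adjacent vertices. -/
structure State.IsSound (st : State V) (G : MixedGraph V) : Prop where
  skeleton_le : G.skeleton ≤ st.H
  sep : ∀ u v, u ≠ v → ¬ st.H.Adj u v →
    ∃ S : Finset V, st.sep u v = some S ∧ u ∉ S ∧ v ∉ S ∧ G.CSep {u} {v} S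

theorem State.isSound_init : (State.init V).IsSound G where
  skeleton_le := le_top
  sep u v huv h := absurd (by simpa [State.init] using huv) h

theorem IsSeparator.cSep (hci : IsPerfect ci G) {H₀ : SimpleGraph V} {i : ℕ} {u v : V}
    {S : Finset V} (hS : IsSeparator ci H₀ i u v S) (huv : u ≠ v) :
    u ∉ S ∧ v ∉ S ∧ G.CSep {u} {v} S := by
  have hu : u ∉ S := fun h => H₀.loopless.irrefl u (hS.1 h).1
  have hv : v ∉ S := fun h => (hS.1 h).2 rfl
  exact ⟨hu, hv, (hci u v S huv hu hv).1 hS.2.2⟩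

theorem Visit.isSound (hci : IsPerfect ci G) {H₀ : SimpleGraph V} {i : ℕ} {u v : V}
    {st st' : State V} (h : Visit ci H₀ i u v st st') (huv : u ≠ v) (hst : st.IsSound G) :
    st'.IsSound G := by
  cases h with
  | keep => exact hst
  | skip => exact hst
  | remove S hS =>
    obtain ⟨hu, hv, hsep⟩ := hS.cSep hci huv
    refine ⟨fun a b hab => ?_, fun a b hab hadj => ?_⟩
    · refine (SimpleGraph.deleteEdges_adj).2 ⟨hst.skeleton_le hab, fun he => ?_⟩
      rcases Sym2.eq_iff.1 (Set.mem_singleton_iff.1 he) with ⟨rfl, rfl⟩ | ⟨rfl, rfl⟩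
      · exact MixedGraph.not_cSep_of_skeleton_adj hu hv hab hsep
      · exact MixedGraph.not_cSep_of_skeleton_adj hu hv hab.symm hsep
    · by_cases he : (a = u ∧ b = v) ∨ (a = v ∧ b = u)
      · refine ⟨S, by simp [State.remove, he], ?_⟩
        rcases he with ⟨rfl, rfl⟩ | ⟨rfl, rfl⟩
        · exact ⟨hu, hv, hsep⟩
        · exact ⟨hv, hu, hsep.symm⟩
      · obtain ⟨T, hT, hT'⟩ := hst.sep a b hab fun hadj' => hadj <|
          (SimpleGraph.deleteEdges_adj).2 ⟨hadj', fun hm =>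
            he (Sym2.eq_iff.1 (Set.mem_singleton_iff.1 hm))⟩
        exact ⟨T, by simp [State.remove, he, hT], hT'⟩

theorem Visit.le {H₀ : SimpleGraph V} {i : ℕ} {u v : V} {st st' : State V}
    (h : Visit ci H₀ i u v st st') : st'.H ≤ st.H := by
  cases h with
  | keep => exact le_rfl
  | skip => exact le_rfl
  | remove S hS => exact SimpleGraph.deleteEdges_le _

theorem Visit.not_adj {H₀ : SimpleGraph V} {i : ℕ} {u v : V} {st st' : State V}
    (h : Visit ci H₀ i u v st st') (hS : ∃ S, IsSeparator ci H₀ i u v S) : ¬ st'.H.Adj u v := by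
  cases h with
  | keep hS' => exact absurd hS hS'
  | skip h => exact h
  | remove S hS => simp [State.remove]

theorem VisitAll.isSound (hci : IsPerfect ci G) {H₀ : SimpleGraph V} {i : ℕ} {ps : List (V × V)}
    {st st' : State V} (h : VisitAll ci H₀ i ps st st') (hps : ∀ p ∈ ps, p.1 ≠ p.2)
    (hst : st.IsSound G) : st'.IsSound G := by
  induction h with
  | nil => exact hst
  | cons u v ps st₁ st₂ st₃ h _ ih =>
    exact ih (fun p hp => hps p (List.mem_cons_of_mem _ hp))
      (h.isSound hci (hps (u, v) List.mem_cons_self) hst)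

theorem VisitAll.le {H₀ : SimpleGraph V} {i : ℕ} {ps : List (V × V)} {st st' : State V}
    (h : VisitAll ci H₀ i ps st st') : st'.H ≤ st.H := by
  induction h with
  | nil => exact le_rfl
  | cons u v ps st₁ st₂ st₃ h _ ih => exact ih.trans h.le

theorem VisitAll.not_adj {H₀ : SimpleGraph V} {i : ℕ} {ps : List (V × V)} {st st' : State V}
    (h : VisitAll ci H₀ i ps st st') {u v : V} (huv : (u, v) ∈ ps)
    (hS : ∃ S, IsSeparator ci H₀ i u v S) : ¬ st'.H.Adj u v := by
  induction h with
  | nil => simp at huv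
  | cons a b ps st₁ st₂ st₃ h hs ih =>
    rcases List.mem_cons.1 huv with he | hmem
    · obtain ⟨rfl, rfl⟩ := Prod.mk.injEq .. ▸ he
      exact fun hadj => h.not_adj hS (hs.le hadj)
    · exact ih hmem

theorem Level.isSound (hci : IsPerfect ci G) {i : ℕ} {st st' : State V} (h : Level ci i st st')
    (hst : st.IsSound G) : st'.IsSound G := by
  obtain ⟨ps, _, hps, h⟩ := h
  exact h.isSound hci (fun p hp => ((hps p.1 p.2).1 hp).1.ne.symm) hst

theorem Level.le {i : ℕ} {st st' : State V} (h : Level ci i st st') : st'.H ≤ st.H := by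
  obtain ⟨ps, _, _, h⟩ := h
  exact h.le

/-- The boundary of `u` lies in the stored adjacency set and omits `v`, so at this level it is an
admissible separator. -/
theorem Level.not_adj [Finite V] (hci : IsPerfect ci G) {st st' : State V} {u v : V}
    (h : Level ci (G.bd u).ncard st st') (hst : st.IsSound G) (huv : u ≠ v)
    (hadj : ¬ G.skeleton.Adj u v) (hsep : G.CSep {u} {v} (G.bd u)) : ¬ st'.H.Adj u v := by
  by_cases hH : st.H.Adj u v
  · obtain ⟨ps, _, hps, h⟩ := h
    have hsub : G.bd u ⊆ st.H.neighborSet u \ {v} := fun w hw =>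
      ⟨hst.skeleton_le (Or.inr (MixedGraph.mem_bd.1 hw)), by
        rintro rfl
        exact hadj (Or.inr (MixedGraph.mem_bd.1 hw))⟩
    refine h.not_adj ((hps u v).2 ⟨hH.symm, Set.ncard_le_ncard hsub (Set.toFinite _)⟩)
      ⟨(Set.toFinite (G.bd u)).toFinset, by simpa using hsub,
        (Set.ncard_eq_toFinset_card _).symm, (hci _ _ _ huv ?_ ?_).2 (by simpa using hsep)⟩
    · simpa [MixedGraph.mem_bd] using G.irrefl u
    · simpa using fun hv => (hsub hv).2 rfl
  · exact fun hadj' => hH (h.le hadj')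

theorem Levels.isSound (hci : IsPerfect ci G) {k : ℕ} {st st' : State V}
    (h : Levels ci k st st') (hst : st.IsSound G) : st'.IsSound G := by
  induction h with
  | zero => exact hst
  | succ k st₁ st₂ st₃ _ h ih => exact h.isSound hci (ih hst)

theorem Levels.not_adj [Finite V] (hci : IsPerfect ci G) {k : ℕ} {st st' : State V}
    (h : Levels ci k st st') (hst : st.IsSound G) {u v : V} (huv : u ≠ v)
    (hadj : ¬ G.skeleton.Adj u v) (hsep : G.CSep {u} {v} (G.bd u)) (hk : (G.bd u).ncard < k) :
    ¬ st'.H.Adj u v := by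
  induction h with
  | zero => omega
  | succ k st₁ st₂ st₃ hs h ih =>
    rcases Nat.lt_succ_iff_lt_or_eq.1 hk with hk | rfl
    · exact fun hadj' => ih hst hk (h.le hadj')
    · exact h.not_adj hci (hs.isSound hci hst) huv hadj hsep

/-- The boundary omits both `u` and `v`; hence the last level `|V| - 2` suffices. -/
theorem ncard_bd_lt [Fintype V] {u v : V} (huv : u ≠ v) (hadj : ¬ G.skeleton.Adj u v) :
    (G.bd u).ncard < Fintype.card V - 1 := by
  have hsub : G.bd u ⊆ ({u, v} : Set V)ᶜ := by
    rintro w hw (rfl | rfl)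
    · exact G.irrefl w (MixedGraph.mem_bd.1 hw)
    · exact hadj (Or.inr (MixedGraph.mem_bd.1 hw))
  have h1 := Set.ncard_le_ncard hsub (Set.toFinite _)
  have h2 := Set.ncard_add_ncard_compl ({u, v} : Set V)
  rw [Set.ncard_pair huv, Nat.card_eq_fintype_card] at h2
  omega

theorem SkeletonRecovery.isSound [Fintype V] (hci : IsPerfect ci G) {st : State V}
    (h : SkeletonRecovery ci st) : st.IsSound G :=
  Levels.isSound hci h State.isSound_init

theorem SkeletonRecovery.eq_skeleton [Fintype V] (hG : G.IsChainGraph) (hci : IsPerfect ci G)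
    {st : State V} (h : SkeletonRecovery ci st) : st.H = G.skeleton := by
  refine le_antisymm (fun u v huv => ?_) (h.isSound hci).skeleton_le
  by_contra hadj
  rcases MixedGraph.cSep_bd_or hG huv.ne with hsep | hsep
  · exact Levels.not_adj hci h State.isSound_init huv.ne hadj hsep (ncard_bd_lt huv.ne hadj) huv
  · have hadj' : ¬ G.skeleton.Adj v u := fun h => hadj h.symm
    exact Levels.not_adj hci h State.isSound_init huv.ne.symm hadj' hsep
      (ncard_bd_lt huv.ne.symm hadj') huv.symm

/-! ### Complex recovery -/

open Classical in
-- If positive tests only point at arrows of `G`, the order of treatment is irrelevant: orientations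
-- never conflict and are never undone.
theorem foldl_orientStep {sep : V → V → Option (Finset V)} (ts : List (V × V × V)) :
    ∀ K : MixedGraph V, K.skeleton = G.skeleton → (∀ a b, K.Arrow a b → G.Arrow a b) →
    (∀ t ∈ ts, (∃ S, sep t.1 t.2.1 = some S ∧ ¬ ci t.1 t.2.1 (insert t.2.2 S)) →
      G.Arrow t.1 t.2.2) →
    (ts.foldl (orientStep ci sep) K).skeleton = G.skeleton ∧
    (∀ a b, (ts.foldl (orientStep ci sep) K).Arrow a b → G.Arrow a b) ∧
    (∀ a b, K.Arrow a b → (ts.foldl (orientStep ci sep) K).Arrow a b) ∧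
    ∀ t ∈ ts, (∃ S, sep t.1 t.2.1 = some S ∧ ¬ ci t.1 t.2.1 (insert t.2.2 S)) →
      (ts.foldl (orientStep ci sep) K).Arrow t.1 t.2.2 := by
  induction ts with
  | nil => exact fun K hs hK _ => ⟨hs, hK, fun _ _ h => h, by simp⟩
  | cons t ts ih =>
    intro K hs hK hts
    have hadj : ∀ a b, K.skeleton.Adj a b ↔ G.skeleton.Adj a b := by simp [hs]
    obtain ⟨hs', hK', hKK', ht⟩ : (orientStep ci sep K t).skeleton = G.skeleton ∧
        (∀ a b, (orientStep ci sep K t).Arrow a b → G.Arrow a b) ∧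
        (∀ a b, K.Arrow a b → (orientStep ci sep K t).Arrow a b) ∧
        ((∃ S, sep t.1 t.2.1 = some S ∧ ¬ ci t.1 t.2.1 (insert t.2.2 S)) →
          (orientStep ci sep K t).Arrow t.1 t.2.2) := by
      by_cases hc : ∃ S, sep t.1 t.2.1 = some S ∧ ¬ ci t.1 t.2.1 (insert t.2.2 S)
      · have hG := hts t List.mem_cons_self hc
        by_cases hl : K.Line t.1 t.2.2
        · rw [orientStep, if_pos ⟨hl, hc⟩]
          have harrow : (K.orient t.1 t.2.2).Arrow t.1 t.2.2 :=
            ⟨⟨hl.1, fun h => MixedGraph.ne_of_E hl.1 h.1⟩, fun h => h.2 ⟨rfl, rfl⟩⟩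
          refine ⟨?_, fun a b hab => ?_, fun a b hab => ?_, fun _ => harrow⟩
          · rw [← hs]
            ext a b
            simp only [MixedGraph.skeleton, MixedGraph.orient]
            constructor
            · tauto
            · intro hab
              by_cases h1 : a = t.2.2 ∧ b = t.1
              · obtain ⟨rfl, rfl⟩ := h1
                exact Or.inr harrow.1
              · by_cases h2 : b = t.2.2 ∧ a = t.1
                · obtain ⟨rfl, rfl⟩ := h2
                  exact Or.inl harrow.1
                · tauto
          · by_cases h2 : b = t.2.2 ∧ a = t.1
            · obtain ⟨rfl, rfl⟩ := h2
              exact hG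
            · exact hK a b ⟨hab.1.1, fun h => hab.2 ⟨h, h2⟩⟩
          · refine ⟨⟨hab.1, ?_⟩, fun h => hab.2 h.1⟩
            rintro ⟨rfl, rfl⟩
            exact hab.2 hl.1
        -- The edge is already directed, and correctly so, because all arrows of `K` are arrows of
        -- `G`.
        · rw [orientStep, if_neg fun h => hl h.1]
          refine ⟨hs, hK, fun _ _ h => h, fun _ => ?_⟩
          by_contra hn
          exact hl (MixedGraph.line_iff.2 ⟨(hadj _ _).2 (Or.inl hG.1), hn,
            fun h => hG.2 (hK _ _ h).1⟩)
      · rw [orientStep, if_neg fun h => hc h.2]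
        exact ⟨hs, hK, fun _ _ h => h, fun h => absurd h hc⟩
    obtain ⟨h1, h2, h3, h4⟩ := ih _ hs' hK' fun t ht => hts t (List.mem_cons_of_mem _ ht)
    refine ⟨h1, h2, fun a b hab => h3 a b (hKK' a b hab), fun t' ht' hc => ?_⟩
    rcases List.mem_cons.1 ht' with rfl | ht'
    · exact h3 _ _ (ht hc)
    · exact h4 t' ht' hc

open Classical in
theorem ComplexRecovery.isRelaxation (hci : IsPerfect ci G) {st : State V} {K : MixedGraph V}
    (hst : st.IsSound G) (hH : st.H = G.skeleton) (h : ComplexRecovery ci st K) :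
    K.IsRelaxation G := by
  obtain ⟨ts, _, hts, rfl⟩ := h
  have hperfect : ∀ {u v w : V} {S : Finset V}, u ≠ v → ¬ G.skeleton.Adj u v →
      G.skeleton.Adj u w → u ∉ S → v ∉ S →
      (ci u v (insert w S) ↔ G.CSep {u} {v} (insert w (S : Set V))) := by
    intro u v w S huv hadj huw hu hv
    rw [hci u v _ huv (by simp [huw.ne, hu]) (by
      simp only [Finset.mem_insert, hv, or_false]
      rintro rfl
      exact hadj huw), Finset.coe_insert]
  obtain ⟨h1, h2, _, h4⟩ := foldl_orientStep (G := G) (ci := ci) (sep := st.sep) ts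
    (MixedGraph.ofSimpleGraph st.H)
    (by
      rw [hH]
      ext a b
      simp [MixedGraph.skeleton, MixedGraph.ofSimpleGraph, or_comm])
    (fun a b hab => absurd (SimpleGraph.Adj.symm hab.1) hab.2) (by
      rintro ⟨u, v, w⟩ ht ⟨S, hS, hnci⟩
      obtain ⟨huv, hadj, huw⟩ := (hts u v w).1 ht
      obtain ⟨S', hS', hu, hv, hsep⟩ := hst.sep u v huv hadj
      obtain rfl : S' = S := Option.some.inj (hS'.symm.trans hS)
      rw [hH] at hadj huw
      exact MixedGraph.arrow_of_not_cSep_insert hsep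
        (fun h => hnci ((hperfect huv hadj huw hu hv).2 h)) huw)
  refine ⟨h1, h2 _ _, fun {a b} hab => ?_⟩
  obtain ⟨r, x, hx, rfl, rfl⟩ := MixedGraph.isComplexArrow_iff.1 hab
  have hne : x ⟨0, by omega⟩ ≠ x ⟨r + 2, by omega⟩ := fun he => by simpa using hx.inj he
  have hw : G.skeleton.Adj (x ⟨0, by omega⟩) (x ⟨1, by omega⟩) := Or.inl hx.left.1
  -- Any recorded set will do: only the absence of both end points from `S` matters, as the test
  -- itself adds the child.
  obtain ⟨S, hS, hu, hv, _⟩ := hst.sep _ _ hne (by rw [hH]; exact hx.not_adj)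
  refine h4 (_, x ⟨r + 2, by omega⟩, _) ((hts _ _ _).2
    ⟨hne, by rw [hH]; exact hx.not_adj, by rw [hH]; exact hw⟩) ⟨S, hS, fun hc => ?_⟩
  refine hx.not_cSep ?_ ?_ (Set.mem_insert _ _) ((hperfect hne hx.not_adj hw hu hv).1 hc)
  · exact fun h => h.elim hw.ne hu
  · simp only [Set.mem_insert_iff, Finset.mem_coe, hv, or_false]
    intro he
    exact hx.not_adj (he ▸ hw)

theorem IsOutput.eq_pattern [Fintype V] (hG : G.IsChainGraph) (hci : IsPerfect ci G)
    {K : MixedGraph V} (h : IsOutput ci K) : K = G.pattern := by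
  obtain ⟨st, K₀, hst, hK₀, rfl⟩ := h
  exact (hK₀.isRelaxation hci (hst.isSound hci) (hst.eq_skeleton hG hci)).pattern_eq

/-! ### The algorithm terminates with an output -/

theorem exists_visit (ci : V → V → Finset V → Prop) (H₀ : SimpleGraph V) (i : ℕ) (u v : V)
    (st : State V) : ∃ st', Visit ci H₀ i u v st st' := by
  by_cases hS : ∃ S, IsSeparator ci H₀ i u v S
  · obtain ⟨S, hS⟩ := hS
    exact ⟨_, .remove st S hS⟩
  · exact ⟨_, .keep st hS⟩

theorem exists_visitAll (ci : V → V → Finset V → Prop) (H₀ : SimpleGraph V) (i : ℕ)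
    (ps : List (V × V)) : ∀ st : State V, ∃ st', VisitAll ci H₀ i ps st st' := by
  induction ps with
  | nil => exact fun st => ⟨st, .nil st⟩
  | cons p ps ih =>
    intro st
    obtain ⟨st₂, h⟩ := exists_visit ci H₀ i p.1 p.2 st
    obtain ⟨st₃, hs⟩ := ih st₂
    exact ⟨st₃, .cons p.1 p.2 ps st st₂ st₃ h hs⟩

theorem exists_nodup_list {α : Type*} [Finite α] (p : α → Prop) :
    ∃ l : List α, l.Nodup ∧ ∀ a, a ∈ l ↔ p a :=
  ⟨(Set.toFinite {a | p a}).toFinset.toList, Finset.nodup_toList _, by simp⟩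

theorem exists_level [Finite V] (ci : V → V → Finset V → Prop) (i : ℕ) (st : State V) :
    ∃ st', Level ci i st st' := by
  obtain ⟨ps, hnd, hps⟩ := exists_nodup_list fun p : V × V =>
    p.1 ∈ st.H.neighborSet p.2 ∧ i ≤ (st.H.neighborSet p.1 \ {p.2}).ncard
  obtain ⟨st', h⟩ := exists_visitAll ci st.H i ps st
  exact ⟨st', ps, hnd, fun u v => hps (u, v), h⟩

theorem exists_levels [Finite V] (ci : V → V → Finset V → Prop) (k : ℕ) (st : State V) :
    ∃ st', Levels ci k st st' := by
  induction k with
  | zero => exact ⟨st, .zero st⟩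
  | succ k ih =>
    obtain ⟨st₂, hs⟩ := ih
    obtain ⟨st₃, h⟩ := exists_level ci k st₂
    exact ⟨st₃, .succ k st st₂ st₃ hs h⟩

/-- Ensures that the claim about all outputs is not vacuous; no assumption on the answers is needed.
-/
theorem exists_isOutput [Fintype V] (ci : V → V → Finset V → Prop) :
    ∃ K : MixedGraph V, IsOutput ci K := by
  obtain ⟨st, hst⟩ := exists_levels ci (Fintype.card V - 1) (State.init V)
  obtain ⟨ts, hnd, hts⟩ := exists_nodup_list fun t : V × V × V =>
    t.1 ≠ t.2.1 ∧ ¬ st.H.Adj t.1 t.2.1 ∧ st.H.Adj t.1 t.2.2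
  exact ⟨_, st, _, hst, ⟨ts, hnd, fun u v w => hts (u, v, w), rfl⟩, rfl⟩

end SPC

end LWF

/-! ### Correctness of the algorithm -/

theorem theorem1 {V : Type*} [Fintype V] {X : V → Type*} [∀ v, MeasurableSpace (X v)]
    [∀ v, StandardBorelSpace (X v)]
    (P : MeasureTheory.Measure (∀ v, X v)) [MeasureTheory.IsProbabilityMeasure P]
    (G : LWF.MixedGraph V) (hG : G.IsChainGraph) (hP : LWF.Faithful P G)
    (ci : V → V → Finset V → Prop)
    (hci : ∀ (u v : V) (S : Finset V), u ≠ v → u ∉ S → v ∉ S →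
      (ci u v S ↔ LWF.CondInd P {u} {v} (S : Set V))) :
    (∃ K : LWF.MixedGraph V, LWF.SPC.IsOutput ci K) ∧
    ∀ K : LWF.MixedGraph V, LWF.SPC.IsOutput ci K →
      K = G.pattern ∧ K.skeleton = G.skeleton ∧
      ∀ (r : ℕ) (x : Fin (r + 3) → V), K.IsMinimalComplex r x ↔ G.IsMinimalComplex r x := by
  have hperfect : LWF.SPC.IsPerfect ci G := fun u v S huv hu hv =>
    (hci u v S huv hu hv).trans (hP {u} {v} S (by simpa using huv) (by simpa using hu)
      (by simpa using hv))
  refine ⟨LWF.SPC.exists_isOutput ci, fun K hK => ?_⟩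
  obtain rfl := hK.eq_pattern hG hperfect
  exact ⟨rfl, LWF.MixedGraph.isRelaxation_pattern.skeleton_eq, fun r x =>
    LWF.MixedGraph.isRelaxation_pattern.isMinimalComplex_iff⟩
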